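/- Consider a Boltzmann machine with $n_v$ visible and $n_h$ hidden binary units whose interaction graph is connected and has $E\ge 1$ edges. Its parameters $\theta$ are one weight per edge and one bias per unit, its energy is $E_\theta(v,h)=-\sum_i b_iv_i-\sum_j d_jh_j-\sum_{\{s,t\}}w_{\{s,t\}}\,s\,t$ (last sum over all edges, $s,t\in\{0,1\}$ the values of the two end units), and $P_\theta(v,h)=e^{-E_\theta(v,h)}/Z_\theta$ is its Gibbs distribution. For training vectors $x_1,\dots,x_N\in\{0,1\}^{n_v}$ $(N\ge1)$ and a regularization parameter $\lambda$ let $$O_{\rm ML}(\theta)=\frac1N\sum_{k=1}^N\log\Big(\sum_hP_\theta(x_k,h)\Big)-\frac\lambda2\,w^Tw .$$ The training vectors are accessed through the quantum oracle $U_O|i\rangle|y\rangle=|i\rangle|y\oplus x_i\rangle$. The cost of a quantum procedure is the expected total number of its quantum operations (one- and two-qubit gates, single-qubit measurements and qubit initializations) and of its calls to $U_O$; classical processing is free. Let any quantum procedure be given for each component $c$ of the parameter vector (for instance one based on amplitude estimation, with or without prior amplitude amplification), and let $N_{\rm op}$ be the largest cost of a single one of these procedures. The full vector is computed by running, for each component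 in turn, its procedure $m$ times and taking the median of the $m$ outputs as the entry for that component. The number of components is $n_v+n_h+E\le 3E=O(E)$. Moreover, for every constant $p>1/2$ there is a constant $C>0$, depending on $p$ only, such that for every $0<\varepsilon<1$ there is a number $m$ of repetitions, depending only on $p$, the graph and $\varepsilon$, with the following two properties, whatever the $N\geq 1$, the training vectors and the procedures are. 1. The cost of computing the full vector is at most $$C\,E\,N_{\rm op}\,\bigl(1+\log(E/\varepsilon)\bigr),$$ that is, $\tilde O(E\,N_{\rm op})$ for constant failure probability $\varepsilon$. 2. For all parameters $\theta$, all $\lambda$, every learning rate $r$ and every $\delta$: if for each component $c$ the given procedure outputs $r\,\partial O_{\rm ML}/\partial\theta_c$ to within error $\delta$ with probability at least $p$, then with probability at least $1-\varepsilon$ the computed vector agrees with $r\,\nabla O_{\rm ML}(\theta)$ to within error $\delta$ in all components simultaneously. In particular the constants do not depend on $r$. -/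

import Mathlib

open scoped BigOperators

noncomputable section

/-! # Boltzmann machines and their maximum-likelihood gradient -/

namespace Boltzmann

/-- The trainable parameters of a Boltzmann machine with `nv` visible and `nh` hidden binary units
whose interaction graph is `G`: one weight for each edge and one bias for each unit
(the biases of the visible units are usually written `b`, those of the hidden units `d`). -/
abbrev Param {nv nh : ℕ} (G : SimpleGraph (Fin nv ⊕ Fin nh)) : Type :=
  G.edgeSet ⊕ (Fin nv ⊕ Fin nh)

variable {nv nh : ℕ} {G : SimpleGraph (Fin nv ⊕ Fin nh)} [DecidableRel G.Adj]

/-- The value (`0` or `1`) of each unit in the configuration `(v, h)`. -/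
def unitValue (v : Fin nv → Bool) (h : Fin nh → Bool) (u : Fin nv ⊕ Fin nh) : ℝ :=
  if Sum.elim v h u then 1 else 0

/-- The energy
`E(v, h) = - ∑ bᵢ vᵢ - ∑ dⱼ hⱼ - ∑ w_e s t`, where the last sum is over all the edges `e = {s, t}`
(visible-hidden, visible-visible and hidden-hidden). -/
def energy (θ : Param G → ℝ) (v : Fin nv → Bool) (h : Fin nh → Bool) : ℝ :=
  - (∑ u : Fin nv ⊕ Fin nh, θ (Sum.inr u) * unitValue v h u)
    - ∑ e : G.edgeSet, θ (Sum.inl e) * Sym2.mul (Sym2.map (unitValue v h) (e : Sym2 _))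

/-- The partition function. -/
def partitionFn (θ : Param G → ℝ) : ℝ :=
  ∑ v : Fin nv → Bool, ∑ h : Fin nh → Bool, Real.exp (-energy θ v h)

/-- The Gibbs distribution at inverse temperature `1`. -/
def gibbs (θ : Param G → ℝ) (v : Fin nv → Bool) (h : Fin nh → Bool) : ℝ :=
  Real.exp (-energy θ v h) / partitionFn θ

/-- The maximum-likelihood objective of the training vectors `x` with `L²`-regularization
parameter `lam`: `(1 / N) ∑ₖ log (∑ₕ P(xₖ, h)) - (lam / 2) wᵀ w`. -/
def objML {N : ℕ} (x : Fin N → Fin nv → Bool) (lam : ℝ) (θ : Param G → ℝ) : ℝ :=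
  (1 / (N : ℝ)) * (∑ k : Fin N, Real.log (∑ h : Fin nh → Bool, gibbs θ (x k) h))
    - lam / 2 * ∑ e : G.edgeSet, θ (Sum.inl e) ^ 2

/-- The component of the gradient of the objective that belongs to the parameter `c`. -/
def gradML {N : ℕ} (x : Fin N → Fin nv → Bool) (lam : ℝ) (θ : Param G → ℝ) (c : Param G) : ℝ :=
  deriv (fun t : ℝ => objML x lam (Function.update θ c t)) (θ c)

end Boltzmann

/-! # Quantum computation with oracle access to the training vectors -/

namespace Quantum

/-- Vectors of amplitudes on `n` qubits. They need not be normalized: in a computation, the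
squared norm of the vector is the probability of the measurement outcomes seen so far. -/
abbrev QState (n : ℕ) : Type := (Fin n → Bool) → ℂ

/-- The squared norm. -/
def normSq {n : ℕ} (ψ : QState n) : ℝ := ∑ b, ‖ψ b‖ ^ 2

/-- The basis state in which all qubits are zero. -/
def ketZero (n : ℕ) : QState n := fun b => if b = (fun _ => false) then 1 else 0

/-- The action of a `k`-qubit unitary `U` on the qubits `e 0, …, e (k - 1)`. -/
def applyGate {n k : ℕ} (e : Fin k ↪ Fin n) (U : Matrix.unitaryGroup (Fin k → Bool) ℂ)
    (ψ : QState n) : QState n :=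
  fun b => ∑ c : Fin k → Bool, (U : Matrix (Fin k → Bool) (Fin k → Bool) ℂ) (fun i => b (e i)) c *
    ψ (Function.extend e c b)

/-- The vector that the oracle adds to the data register when the bits of the index register
are `a`: the training vector whose number has the binary digits `a`, if there is one. -/
def trainingVector {nv ℓ N : ℕ} (x : Fin N → Fin nv → Bool) (a : Fin ℓ → Bool) : Fin nv → Bool :=
  if hi : (∑ k : Fin ℓ, if a k then 2 ^ (k : ℕ) else 0) < N then x ⟨_, hi⟩ else fun _ => false

/-- The oracle `|i⟩|y⟩ ↦ |i⟩|y ⊕ xᵢ⟩`, where the index register consists of the qubits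
`e (Sum.inl 0), e (Sum.inl 1), …` and the data register of the qubits
`e (Sum.inr 0), e (Sum.inr 1), …`. The map on basis states is its own inverse. -/
def applyOracle {nv ℓ N n : ℕ} (x : Fin N → Fin nv → Bool) (e : (Fin ℓ ⊕ Fin nv) ↪ Fin n)
    (ψ : QState n) : QState n :=
  fun b => ψ (Function.extend (fun i : Fin nv => e (Sum.inr i))
    (fun i => xor (b (e (Sum.inr i))) (trainingVector x (fun k => b (e (Sum.inl k))) i)) b)

/-- The part of `ψ` in which the qubit `q` has the value `β`. -/
def project {n : ℕ} (q : Fin n) (β : Bool) (ψ : QState n) : QState n :=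
  fun b => if b q = β then ψ b else 0

/-- Quantum algorithms with classical output in `α`, acting on a register of the given number of
qubits. They may use arbitrary one- and two-qubit gates, the oracle (with an `ℓ`-bit index and an
`nv`-bit data register), measurements in the computational basis on whose outcomes all later steps
may depend, and they may discard the register and take a new one with all its qubits zero. -/
inductive Prog (nv ℓ : ℕ) (α : Type) : ℕ → Type
  | ret {n : ℕ} (a : α) : Prog nv ℓ α n
  | gate {n : ℕ} (k : ℕ) (hk : k ≤ 2) (e : Fin k ↪ Fin n)
      (U : Matrix.unitaryGroup (Fin k → Bool) ℂ) (next : Prog nv ℓ α n) : Prog nv ℓ α n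
  | query {n : ℕ} (e : (Fin ℓ ⊕ Fin nv) ↪ Fin n) (next : Prog nv ℓ α n) : Prog nv ℓ α n
  | measure {n : ℕ} (q : Fin n) (next : Bool → Prog nv ℓ α n) : Prog nv ℓ α n
  | init {n : ℕ} (n' : ℕ) (next : Prog nv ℓ α n') : Prog nv ℓ α n

/-- A complete procedure: it starts without any qubits and has to initialize those it uses. -/
abbrev Procedure (nv ℓ : ℕ) (α : Type) : Type := Prog nv ℓ α 0

namespace Prog

variable {nv ℓ N : ℕ} {α β : Type}

/-- The expectation of `f` of the output when the register is in the state `ψ` (Born rule),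
weighted with the squared norm of `ψ`. -/
def expect (x : Fin N → Fin nv → Bool) (f : α → ℝ) : {n : ℕ} → Prog nv ℓ α n → QState n → ℝ
  | _, ret a, ψ => normSq ψ * f a
  | _, gate _ _ e U next, ψ => expect x f next (applyGate e U ψ)
  | _, query e next, ψ => expect x f next (applyOracle x e ψ)
  | _, measure q next, ψ =>
      expect x f (next false) (project q false ψ) + expect x f (next true) (project q true ψ)
  | _, init n' next, ψ => normSq ψ * expect x f next (ketZero n')

/-- The expected number of operations, weighted with the squared norm of the state `ψ` of the
register. Each gate, each oracle call, each measurement of a qubit and each initialization of a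
qubit is one operation. -/
def opCount (x : Fin N → Fin nv → Bool) : {n : ℕ} → Prog nv ℓ α n → QState n → ℝ
  | _, ret _, _ => 0
  | _, gate _ _ e U next, ψ => normSq ψ + opCount x next (applyGate e U ψ)
  | _, query e next, ψ => normSq ψ + opCount x next (applyOracle x e ψ)
  | _, measure q next, ψ => normSq ψ +
      (opCount x (next false) (project q false ψ) + opCount x (next true) (project q true ψ))
  | _, init n' next, ψ => normSq ψ * (n' + opCount x next (ketZero n'))

/-- Run a program, discard its register, and run a procedure that depends on its output. -/
def andThen : {n : ℕ} → Prog nv ℓ α n → (α → Procedure nv ℓ β) → Prog nv ℓ β n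
  | _, ret a, k => init 0 (k a)
  | _, gate j hj e U next, k => gate j hj e U (andThen next k)
  | _, query e next, k => query e (andThen next k)
  | _, measure q next, k => measure q (fun o => andThen (next o) k)
  | _, init n' next, k => init n' (andThen next k)

end Prog

namespace Procedure

variable {nv ℓ N : ℕ} {α : Type}

/-- The probability that the output of the procedure lies in `S`, for the training vectors `x`. -/
def prob (x : Fin N → Fin nv → Bool) (P : Procedure nv ℓ α) (S : Set α) : ℝ :=
  Prog.expect x (S.indicator 1) P (ketZero 0)

/-- The expected number of quantum operations and oracle calls of the procedure. -/
def expectedOps (x : Fin N → Fin nv → Bool) (P : Procedure nv ℓ α) : ℝ :=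
  Prog.opCount x P (ketZero 0)

/-- Run the procedure `m` times and list the outputs. -/
def runs (P : Procedure nv ℓ α) : ℕ → Procedure nv ℓ (List α)
  | 0 => Prog.ret []
  | m + 1 => Prog.andThen P fun y => Prog.andThen (runs P m) fun l => Prog.ret (y :: l)

/-- The median of a list of real numbers. -/
def median (l : List ℝ) : ℝ := (l.insertionSort (· ≤ ·)).getD (l.length / 2) 0

/-- Run the procedure `m` times and output the median of the results. -/
def medianOfRuns (P : Procedure nv ℓ ℝ) (m : ℕ) : Procedure nv ℓ ℝ :=
  Prog.andThen (runs P m) fun l => Prog.ret (median l)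

/-- For each component `c` in a list, one after the other, run `A c` for `m` times and store the
median of the results as the entry `c` of the vector `g`. -/
def fillEntries {ι : Type} [DecidableEq ι] (A : ι → Procedure nv ℓ ℝ) (m : ℕ) :
    List ι → (ι → ℝ) → Procedure nv ℓ (ι → ℝ)
  | [], g => Prog.ret g
  | c :: cs, g => Prog.andThen (medianOfRuns (A c) m) fun y =>
      fillEntries A m cs (Function.update g c y)

/-- Compute a vector component by component: given a procedure `A c` for each component `c`, run
each of them `m` times and output the vector of the medians. -/
def componentwise {ι : Type} [Fintype ι] [DecidableEq ι] (A : ι → Procedure nv ℓ ℝ) (m : ℕ) :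
    Procedure nv ℓ (ι → ℝ) :=
  fillEntries A m Finset.univ.toList 0

/-- The number of quantum operations and oracle calls that suffices for a single component:
the largest expected number over all the components. -/
def opsPerComponent {ι : Type} (x : Fin N → Fin nv → Bool) (A : ι → Procedure nv ℓ ℝ) : ℝ :=
  ⨆ c, expectedOps x (A c)

end Procedure

/-- For the training vectors `x`, the procedure `P` computes `r` times the component `c` of the
gradient of the maximum-likelihood objective to within error `δ`, with probability at least `p`. -/
def ComputesComponent {nv nh ℓ N : ℕ} {G : SimpleGraph (Fin nv ⊕ Fin nh)} [DecidableRel G.Adj]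
    (x : Fin N → Fin nv → Bool) (lam r : ℝ) (θ : Boltzmann.Param G → ℝ) (δ p : ℝ)
    (c : Boltzmann.Param G) (P : Procedure nv ℓ ℝ) : Prop :=
  p ≤ P.prob x {y | |y - r * Boltzmann.gradML x lam θ c| ≤ δ}

/-- For the training vectors `x`, the procedure `P` computes `r` times the gradient of the
maximum-likelihood objective, all its components simultaneously to within error `δ`, with
probability at least `p`. -/
def ComputesGradient {nv nh ℓ N : ℕ} {G : SimpleGraph (Fin nv ⊕ Fin nh)} [DecidableRel G.Adj]
    (x : Fin N → Fin nv → Bool) (lam r : ℝ) (θ : Boltzmann.Param G → ℝ) (δ p : ℝ)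
    (P : Procedure nv ℓ (Boltzmann.Param G → ℝ)) : Prop :=
  p ≤ P.prob x {g | ∀ c, |g c - r * Boltzmann.gradML x lam θ c| ≤ δ}

end Quantum

end

/-! The gradient enters only through the shape of its error sets: "within `δ` of the true value" is
an interval. If the median of `m` outputs misses an interval, at least half of the outputs miss it.
Runs on fresh registers are independent, and each misses with probability at most `1 - p < 1/2`, so
a Chernoff bound makes the median fail with probability at most `exp (-d m)`, `d = (2p-1)²/2`
(`prob_medianOfRuns_compl_le`). A union bound over the at most `3E` components
(`prob_fillEntries_compl_le`) leaves failure at most `ε` once `m ≥ log (3E/ε) / d`. The expected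
cost is exactly `m` times the sum of the component costs. Independence is read off the Born rule:
norms are preserved, so `expect` is a genuine expectation, and `expect_andThen` makes it compose. -/

namespace Quantum

variable {nv ℓ N n : ℕ}

/-! ### Norm of the state under the elementary operations -/

theorem normSq_nonneg (ψ : QState n) : 0 ≤ normSq ψ :=
  Finset.sum_nonneg fun _ _ => by positivity

theorem normSq_ketZero (n : ℕ) : normSq (ketZero n) = 1 := by
  unfold normSq ketZero
  rw [Finset.sum_eq_single (fun _ => false)]
  · simp
  · intro b _ hb
    simp [hb]
  · simp

theorem normSq_project_add (q : Fin n) (ψ : QState n) :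
    normSq (project q false ψ) + normSq (project q true ψ) = normSq ψ := by
  unfold normSq project
  rw [← Finset.sum_add_distrib]
  refine Finset.sum_congr rfl fun b _ => ?_
  cases h : b q <;> simp

/-- A unitary matrix preserves the sum of the squared moduli of the coordinates. -/
theorem sum_norm_sq_unitary {κ : Type*} [Fintype κ] [DecidableEq κ]
    (U : Matrix.unitaryGroup κ ℂ) (φ : κ → ℂ) :
    ∑ a, ‖∑ c, (U : Matrix κ κ ℂ) a c * φ c‖ ^ 2 = ∑ c, ‖φ c‖ ^ 2 := by
  have key : ∀ v : κ → ℂ, ((∑ a, ‖v a‖ ^ 2 : ℝ) : ℂ) = star v ⬝ᵥ v := by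
    intro v
    simp only [dotProduct, Pi.star_apply, Complex.ofReal_sum]
    refine Finset.sum_congr rfl fun a _ => ?_
    rw [RCLike.star_def, Complex.conj_mul']
    push_cast
    rfl
  have hU : star ((U : Matrix κ κ ℂ).mulVec φ) ⬝ᵥ (U : Matrix κ κ ℂ).mulVec φ = star φ ⬝ᵥ φ := by
    rw [Matrix.star_mulVec, ← Matrix.dotProduct_mulVec, Matrix.mulVec_mulVec,
      ← Matrix.star_eq_conjTranspose, Matrix.UnitaryGroup.star_mul_self, Matrix.one_mulVec]
  rw [← key, ← key] at hU
  exact_mod_cast hU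

/-- Averaging a sum over all bit strings over the values of some of the bits. -/
theorem sum_sum_extend {k : ℕ} (e : Fin k ↪ Fin n) (F : (Fin n → Bool) → ℝ) :
    ∑ b : Fin n → Bool, ∑ a : Fin k → Bool, F (Function.extend e a b)
      = ∑ b : Fin n → Bool, ∑ _a : Fin k → Bool, F b := by
  rw [← Fintype.sum_prod_type', ← Fintype.sum_prod_type']
  -- Swap the bits of `b` at the positions `e` with the separate string `a`; this reindexes the sum
  -- over pairs.
  let σ : (Fin n → Bool) × (Fin k → Bool) → (Fin n → Bool) × (Fin k → Bool) :=
    fun z => (Function.extend e z.2 z.1, fun i => z.1 (e i))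
  have hσ : Function.Involutive σ := by
    rintro ⟨b, a⟩
    refine Prod.ext (funext fun j => ?_) (funext fun i => e.injective.extend_apply _ _ _)
    by_cases hj : ∃ i, e i = j
    · obtain ⟨i, rfl⟩ := hj
      exact e.injective.extend_apply _ _ _
    · exact (Function.extend_apply' _ _ _ hj).trans (Function.extend_apply' _ _ _ hj)
  exact Fintype.sum_equiv hσ.toPerm _ (fun z => F z.1) fun _ => rfl

/-- With the bits outside `e` frozen, the gate is `U` acting on `2 ^ k` amplitudes. Averaging over
the bits at `e` reduces the claim to these blocks, and the common factor `2 ^ k` cancels. -/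
theorem normSq_applyGate {k : ℕ} (e : Fin k ↪ Fin n) (U : Matrix.unitaryGroup (Fin k → Bool) ℂ)
    (ψ : QState n) : normSq (applyGate e U ψ) = normSq ψ := by
  have hext : ∀ (a c : Fin k → Bool) (b : Fin n → Bool),
      Function.extend e c (Function.extend e a b) = Function.extend e c b := by
    intro a c b
    funext j
    by_cases hj : ∃ i, e i = j
    · obtain ⟨i, rfl⟩ := hj
      rw [e.injective.extend_apply, e.injective.extend_apply]
    · rw [Function.extend_apply' _ _ _ hj, Function.extend_apply' _ _ _ hj,
        Function.extend_apply' _ _ _ hj]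
  have h1 := sum_sum_extend e fun b => ‖applyGate e U ψ b‖ ^ 2
  have h2 := sum_sum_extend e fun b => ‖ψ b‖ ^ 2
  have h3 : ∀ b : Fin n → Bool,
      ∑ a : Fin k → Bool, ‖applyGate e U ψ (Function.extend e a b)‖ ^ 2
        = ∑ a : Fin k → Bool, ‖ψ (Function.extend e a b)‖ ^ 2 := by
    intro b
    refine Eq.trans (Finset.sum_congr rfl fun a _ => ?_)
      (sum_norm_sq_unitary U fun a => ψ (Function.extend e a b))
    simp only [applyGate, hext, e.injective.extend_apply]
  rw [Finset.sum_congr rfl fun b _ => h3 b, h2] at h1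
  simp only [Finset.sum_const, ← Finset.smul_sum] at h1
  exact (smul_right_injective ℝ (Finset.card_pos.2 Finset.univ_nonempty).ne' h1).symm

/-- The oracle permutes basis states: index and data qubits are disjoint, so the index survives and
a second xor undoes the first. -/
theorem normSq_applyOracle (x : Fin N → Fin nv → Bool) (e : (Fin ℓ ⊕ Fin nv) ↪ Fin n)
    (ψ : QState n) : normSq (applyOracle x e ψ) = normSq ψ := by
  have hinj : Function.Injective fun i : Fin nv => e (Sum.inr i) :=
    e.injective.comp Sum.inr_injective
  let σ : (Fin n → Bool) → (Fin n → Bool) := fun b =>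
    Function.extend (fun i : Fin nv => e (Sum.inr i))
      (fun i => xor (b (e (Sum.inr i))) (trainingVector x (fun k => b (e (Sum.inl k))) i)) b
  have hinl : ∀ b k, σ b (e (Sum.inl k)) = b (e (Sum.inl k)) := by
    intro b k
    refine Function.extend_apply' _ _ _ ?_
    rintro ⟨i, hi⟩
    cases e.injective hi
  have hinr : ∀ b i, σ b (e (Sum.inr i)) =
      xor (b (e (Sum.inr i))) (trainingVector x (fun k => b (e (Sum.inl k))) i) :=
    fun b i => hinj.extend_apply _ _ _
  have hσ : Function.Involutive σ := by
    intro b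
    funext j
    by_cases hj : ∃ i : Fin nv, e (Sum.inr i) = j
    · obtain ⟨i, rfl⟩ := hj
      simp only [hinr, hinl, Bool.xor_assoc, Bool.xor_self, Bool.xor_false]
    · exact (Function.extend_apply' _ _ _ hj).trans (Function.extend_apply' _ _ _ hj)
  exact Fintype.sum_equiv hσ.toPerm _ (fun b => ‖ψ b‖ ^ 2) fun _ => rfl

/-! ### Expectation and cost along a program -/

namespace Prog

variable {α β : Type} (x : Fin N → Fin nv → Bool)

/-- The second procedure sees only the classical output, since `init 0` discards the register and
keeps its squared norm as a weight. -/
theorem expect_andThen (f : β → ℝ) (P : Prog nv ℓ α n) (k : α → Procedure nv ℓ β)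
    (ψ : QState n) :
    expect x f (andThen P k) ψ = expect x (fun a => expect x f (k a) (ketZero 0)) P ψ := by
  induction P with
  | ret a => rfl
  | gate j hj e U next ih => exact ih _
  | query e next ih => exact ih _
  | measure q next ih => exact congrArg₂ (· + ·) (ih false _) (ih true _)
  | init n' next ih => exact congrArg (normSq ψ * ·) (ih _)

theorem opCount_andThen (P : Prog nv ℓ α n) (k : α → Procedure nv ℓ β) (ψ : QState n) :
    opCount x (andThen P k) ψ
      = opCount x P ψ + expect x (fun a => opCount x (k a) (ketZero 0)) P ψ := by
  induction P with
  | ret a => simp [andThen, opCount, expect]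
  | gate j hj e U next ih => simp only [andThen, opCount, expect, ih, add_assoc]
  | query e next ih => simp only [andThen, opCount, expect, ih, add_assoc]
  | measure q next ih => simp only [andThen, opCount, expect, ih]; ring
  | init n' next ih => simp only [andThen, opCount, expect, ih]; ring

/-- Conservation of total probability; the norm identities for gates, queries and measurements serve
this purpose. -/
theorem expect_const (a : ℝ) (P : Prog nv ℓ α n) (ψ : QState n) :
    expect x (fun _ => a) P ψ = normSq ψ * a := by
  induction P with
  | ret _ => rfl
  | gate j hj e U next ih => simp only [expect, ih, normSq_applyGate]
  | query e next ih => simp only [expect, ih, normSq_applyOracle]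
  | measure q next ih => simp only [expect, ih, ← add_mul, normSq_project_add]
  | init n' next ih => simp only [expect, ih, normSq_ketZero, one_mul]

theorem expect_add (f g : α → ℝ) (P : Prog nv ℓ α n) (ψ : QState n) :
    expect x (fun a => f a + g a) P ψ = expect x f P ψ + expect x g P ψ := by
  induction P with
  | ret _ => simp only [expect, mul_add]
  | gate j hj e U next ih => exact ih _
  | query e next ih => exact ih _
  | measure q next ih => simp only [expect, ih]; ring
  | init n' next ih => simp only [expect, ih, mul_add]

theorem expect_const_mul (r : ℝ) (f : α → ℝ) (P : Prog nv ℓ α n) (ψ : QState n) :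
    expect x (fun a => r * f a) P ψ = r * expect x f P ψ := by
  induction P with
  | ret _ => simp only [expect, mul_left_comm]
  | gate j hj e U next ih => exact ih _
  | query e next ih => exact ih _
  | measure q next ih => simp only [expect, ih, mul_add]
  | init n' next ih => simp only [expect, ih, mul_left_comm]

theorem expect_mono {f g : α → ℝ} (hfg : ∀ a, f a ≤ g a) (P : Prog nv ℓ α n) (ψ : QState n) :
    expect x f P ψ ≤ expect x g P ψ := by
  induction P with
  | ret a => exact mul_le_mul_of_nonneg_left (hfg a) (normSq_nonneg ψ)
  | gate j hj e U next ih => exact ih _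
  | query e next ih => exact ih _
  | measure q next ih => exact add_le_add (ih false _) (ih true _)
  | init n' next ih => exact mul_le_mul_of_nonneg_left (ih _) (normSq_nonneg ψ)

theorem opCount_nonneg (P : Prog nv ℓ α n) (ψ : QState n) : 0 ≤ opCount x P ψ := by
  induction P with
  | ret _ => exact le_rfl
  | gate j hj e U next ih => exact add_nonneg (normSq_nonneg _) (ih _)
  | query e next ih => exact add_nonneg (normSq_nonneg _) (ih _)
  | measure q next ih =>
    exact add_nonneg (normSq_nonneg _) (add_nonneg (ih false _) (ih true _))
  | init n' next ih =>
    exact mul_nonneg (normSq_nonneg _) (add_nonneg (Nat.cast_nonneg _) (ih _))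

end Prog

/-! ### Probabilities and costs of repeated procedures -/

namespace Procedure

open Prog

variable {α β : Type} (x : Fin N → Fin nv → Bool)

theorem expect_const_ketZero (a : ℝ) (P : Procedure nv ℓ α) :
    expect x (fun _ => a) P (ketZero 0) = a := by
  rw [expect_const, normSq_ketZero, one_mul]

theorem expect_ret_ketZero (f : α → ℝ) (a : α) :
    expect x f (ret a : Procedure nv ℓ α) (ketZero 0) = f a := by
  rw [expect, normSq_ketZero, one_mul]

theorem prob_le_one (P : Procedure nv ℓ α) (S : Set α) : P.prob x S ≤ 1 := by
  rw [prob, ← expect_const_ketZero x 1 P]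
  exact expect_mono x (fun a => Set.indicator_le_self' (fun _ _ => zero_le_one) a) P _

theorem prob_compl (P : Procedure nv ℓ α) (S : Set α) : P.prob x Sᶜ = 1 - P.prob x S := by
  have h := expect_add x (S.indicator 1) (Sᶜ.indicator 1) P (ketZero 0)
  have h1 : (fun a => S.indicator (1 : α → ℝ) a + Sᶜ.indicator 1 a) = fun _ => 1 :=
    funext fun a => congrFun (Set.indicator_self_add_compl S (1 : α → ℝ)) a
  rw [h1, expect_const_ketZero] at h
  unfold prob
  linarith

theorem expectedOps_andThen_of_const (P : Procedure nv ℓ α) (k : α → Procedure nv ℓ β) (t : ℝ)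
    (hk : ∀ a, (k a).expectedOps x = t) :
    expectedOps x (andThen P k) = P.expectedOps x + t := by
  unfold expectedOps at *
  rw [opCount_andThen]
  simp only [hk, expect_const_ketZero]

theorem expectedOps_ret (a : α) : expectedOps x (ret a : Procedure nv ℓ α) = 0 := rfl

theorem expectedOps_runs (P : Procedure nv ℓ α) (m : ℕ) :
    (runs P m).expectedOps x = m * P.expectedOps x := by
  induction m with
  | zero => simp [runs, expectedOps_ret]
  | succ m ih =>
    rw [runs, expectedOps_andThen_of_const x _ _ (m * P.expectedOps x)]
    · push_cast
      ring
    · intro a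
      rw [expectedOps_andThen_of_const x _ _ 0 fun _ => rfl, ih, add_zero]

theorem expectedOps_medianOfRuns (P : Procedure nv ℓ ℝ) (m : ℕ) :
    (medianOfRuns P m).expectedOps x = m * P.expectedOps x := by
  rw [medianOfRuns, expectedOps_andThen_of_const x _ _ 0 fun _ => rfl, expectedOps_runs, add_zero]

theorem expectedOps_fillEntries {ι : Type} [DecidableEq ι] (A : ι → Procedure nv ℓ ℝ) (m : ℕ)
    (cs : List ι) (g : ι → ℝ) :
    (fillEntries A m cs g).expectedOps x = (cs.map fun c => m * (A c).expectedOps x).sum := by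
  induction cs generalizing g with
  | nil => rfl
  | cons c cs ih =>
    rw [fillEntries, expectedOps_andThen_of_const x _ _ _ fun y => ih _, expectedOps_medianOfRuns,
      List.map_cons, List.sum_cons]

theorem expectedOps_componentwise {ι : Type} [Fintype ι] [DecidableEq ι]
    (A : ι → Procedure nv ℓ ℝ) (m : ℕ) :
    (componentwise A m).expectedOps x = m * ∑ c, (A c).expectedOps x := by
  rw [componentwise, expectedOps_fillEntries, Finset.sum_map_toList, Finset.mul_sum]

theorem expectedOps_componentwise_le {ι : Type} [Fintype ι] [DecidableEq ι]
    (A : ι → Procedure nv ℓ ℝ) (m : ℕ) :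
    (componentwise A m).expectedOps x ≤ m * (Fintype.card ι * opsPerComponent x A) := by
  rw [expectedOps_componentwise]
  refine mul_le_mul_of_nonneg_left ?_ (Nat.cast_nonneg m)
  rw [← nsmul_eq_mul]
  exact Finset.sum_le_card_nsmul _ _ _ fun c _ =>
    le_ciSup (f := fun c => (A c).expectedOps x) (Set.finite_range _).bddAbove c

theorem opsPerComponent_nonneg {ι : Type} (A : ι → Procedure nv ℓ ℝ) : 0 ≤ opsPerComponent x A :=
  Real.iSup_nonneg fun c => opCount_nonneg x (A c) _

/-! ### Amplification by medians and the union bound -/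

/-- The outputs of the runs are independent. -/
theorem expect_runs_prod (P : Procedure nv ℓ α) (g : α → ℝ) (m : ℕ) :
    expect x (fun l => (l.map g).prod) (runs P m) (ketZero 0) = expect x g P (ketZero 0) ^ m := by
  induction m with
  | zero => rw [runs, expect_ret_ketZero, List.map_nil, List.prod_nil, pow_zero]
  | succ m ih =>
    simp only [runs, expect_andThen, expect_ret_ketZero, List.map_cons, List.prod_cons,
      expect_const_mul, ih]
    simp only [mul_comm _ (expect x g P (ketZero 0) ^ m), expect_const_mul]
    rw [pow_succ]

/-- If the median of a list lies outside an interval, so does at least half of the list. -/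
theorem length_le_two_mul_countP_of_median_notMem {S : Set ℝ} (hS : S.OrdConnected)
    [DecidablePred (· ∈ S)] {l : List ℝ} (hl : median l ∉ S) :
    l.length ≤ 2 * l.countP (· ∉ S) := by
  set s := l.insertionSort (· ≤ ·) with hs
  have hperm : s.Perm l := List.perm_insertionSort _ l
  have hlen : s.length = l.length := hperm.length_eq
  have hsorted : s.Pairwise (· ≤ ·) := List.pairwise_insertionSort _ l
  rw [← hperm.countP_eq, ← hlen]
  rcases Nat.eq_zero_or_pos s.length with h0 | hpos
  · omega
  have hmid : s.length / 2 < s.length := by omega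
  have hmed : median l = s[s.length / 2] := by
    rw [median, ← hs, ← hlen, List.getD_eq_getElem _ _ hmid]
  rw [hmed] at hl
  have hmono : ∀ i j (hi : i < s.length) (hj : j < s.length), i ≤ j → s[i] ≤ s[j] :=
    fun i j hi hj hij => hsorted.rel_get_of_le (a := ⟨i, hi⟩) (b := ⟨j, hj⟩) hij
  -- If some entry up to the middle lies in `S`, convexity keeps the middle and everything above it
  -- out of `S`. Otherwise all entries up to the middle miss `S`. Either block is at least half of
  -- the list.
  by_cases hbelow : ∃ i, ∃ hi : i < s.length, i ≤ s.length / 2 ∧ s[i] ∈ S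
  · obtain ⟨i, hi, hle, hiS⟩ := hbelow
    have hall : ∀ y ∈ s.drop (s.length / 2), decide (y ∉ S) = true := by
      intro y hy
      obtain ⟨j, hj, rfl⟩ := List.mem_iff_getElem.1 hy
      rw [List.length_drop] at hj
      rw [List.getElem_drop, decide_eq_true_iff]
      intro hjS
      exact hl (hS.out hiS hjS ⟨hmono _ _ _ _ hle, hmono _ _ _ _ (Nat.le_add_right _ _)⟩)
    have hsub := (List.drop_sublist (s.length / 2) s).countP_le (p := (· ∉ S))
    rw [List.countP_eq_length.2 hall, List.length_drop] at hsub
    omega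
  · have hall : ∀ y ∈ s.take (s.length / 2 + 1), decide (y ∉ S) = true := by
      intro y hy
      obtain ⟨j, hj, rfl⟩ := List.mem_iff_getElem.1 hy
      rw [List.length_take] at hj
      rw [List.getElem_take, decide_eq_true_iff]
      exact fun hjS => hbelow ⟨j, by omega, by omega, hjS⟩
    have hsub := (List.take_sublist (s.length / 2 + 1) s).countP_le (p := (· ∉ S))
    rw [List.countP_eq_length.2 hall, List.length_take] at hsub
    omega

/-- The product is `s` to the power (misses − hits) = (2 · misses − length); the factor `s ^
l.length` avoids negative exponents. -/
theorem prod_map_ite_mul_pow_length {S : Set α} [DecidablePred (· ∈ S)] {s : ℝ} (hs : s ≠ 0)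
    (l : List α) :
    (l.map fun y => if y ∈ S then s⁻¹ else s).prod * s ^ l.length
      = s ^ (2 * l.countP (· ∉ S)) := by
  induction l with
  | nil => simp
  | cons y l ih =>
    rw [List.map_cons, List.prod_cons, List.length_cons, List.countP_cons]
    by_cases hy : y ∈ S
    · simp only [hy, if_true, not_true, decide_false, Bool.false_eq_true, if_false, add_zero]
      rw [← ih, pow_succ]
      field_simp
    · simp only [hy, if_false, not_false_eq_true, decide_true, if_true]
      rw [mul_add, pow_add s (2 * _), ← ih, pow_succ s l.length]
      ring

theorem expect_ite (P : Procedure nv ℓ α) (S : Set α) [DecidablePred (· ∈ S)] (a b : ℝ) :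
    expect x (fun y => if y ∈ S then a else b) P (ketZero 0)
      = a * P.prob x S + b * (1 - P.prob x S) := by
  rw [← prob_compl, prob, prob, ← expect_const_mul, ← expect_const_mul, ← expect_add]
  congr 1
  funext y
  by_cases hy : y ∈ S <;> simp [hy]

/-- Amplification of the success probability by the median of independent runs. -/
theorem prob_medianOfRuns_compl_le {p : ℝ} (hp : 1 / 2 < p) (P : Procedure nv ℓ ℝ) {S : Set ℝ}
    (hS : S.OrdConnected) (hP : p ≤ P.prob x S) (m : ℕ) :
    (medianOfRuns P m).prob x Sᶜ ≤ Real.exp (-((2 * p - 1) ^ 2 / 2 * m)) := by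
  classical
  have hs : 1 ≤ 2 * p := by linarith
  have hs0 : 0 < 2 * p := by linarith
  have hinv : (2 * p)⁻¹ ≤ 2 * p := (inv_le_one_of_one_le₀ hs).trans hs
  -- Chernoff weight with base `2p`: the product over the runs is at least `1` whenever the median
  -- misses `S`.
  set g : ℝ → ℝ := fun y => if y ∈ S then (2 * p)⁻¹ else 2 * p with hg
  have hg0 : ∀ y, 0 ≤ g y := fun y => by
    simp only [hg]
    split_ifs <;> positivity
  have hE0 : 0 ≤ expect x g P (ketZero 0) := by
    rw [← expect_const_ketZero x 0 P]
    exact expect_mono x hg0 P _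
  have hE : expect x g P (ketZero 0) ≤ Real.exp (-((2 * p - 1) ^ 2 / 2)) := by
    refine le_trans ?_ (Real.add_one_le_exp _)
    rw [hg, expect_ite]
    -- As `g` is smaller on `S`, the worst case is success probability exactly `p`, where the mean
    -- is `1/2 + 2p(1-p) = 1 - (2p-1)²/2`.
    have h1 := mul_nonneg (sub_nonneg.2 hinv) (sub_nonneg.2 hP)
    have h2 : (2 * p)⁻¹ * p = 1 / 2 := by
      field_simp
    nlinarith
  calc (medianOfRuns P m).prob x Sᶜ
      = expect x (fun l => Sᶜ.indicator 1 (median l)) (runs P m) (ketZero 0) := by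
        simp only [prob, medianOfRuns, expect_andThen, expect_ret_ketZero]
    _ ≤ expect x (fun l => (l.map g).prod) (runs P m) (ketZero 0) := by
        refine expect_mono x (fun l => ?_) _ _
        by_cases hl : median l ∈ S
        · rw [Set.indicator_of_notMem (Set.notMem_compl_iff.2 hl)]
          refine List.prod_nonneg fun a ha => ?_
          obtain ⟨y, -, rfl⟩ := List.mem_map.1 ha
          exact hg0 y
        · rw [Set.indicator_of_mem (Set.mem_compl hl), Pi.one_apply]
          have h := prod_map_ite_mul_pow_length (S := S) hs0.ne' l
          have h' := pow_le_pow_right₀ hs (length_le_two_mul_countP_of_median_notMem hS hl)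
          rw [← h] at h'
          exact le_of_mul_le_mul_right (by rwa [one_mul]) (pow_pos hs0 l.length)
    _ = expect x g P (ketZero 0) ^ m := expect_runs_prod x P g m
    _ ≤ Real.exp (-((2 * p - 1) ^ 2 / 2)) ^ m := pow_le_pow_left₀ hE0 hE m
    _ = Real.exp (-((2 * p - 1) ^ 2 / 2 * m)) := by
        rw [← Real.exp_nat_mul]
        ring_nf

/-- The union bound for a vector that is computed entry by entry. -/
theorem prob_fillEntries_compl_le {ι : Type} [DecidableEq ι] (A : ι → Procedure nv ℓ ℝ) (m : ℕ)
    (S : ι → Set ℝ) {η : ℝ} (hA : ∀ c, (medianOfRuns (A c) m).prob x (S c)ᶜ ≤ η)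
    (cs : List ι) (g : ι → ℝ) (hg : ∀ c, c ∉ cs → g c ∈ S c) :
    (fillEntries A m cs g).prob x {g | ∀ c, g c ∈ S c}ᶜ ≤ cs.length * η := by
  induction cs generalizing g with
  | nil =>
    have hmem : g ∉ {g : ι → ℝ | ∀ c, g c ∈ S c}ᶜ :=
      Set.notMem_compl_iff.2 fun c => hg c (List.not_mem_nil)
    rw [prob, fillEntries, expect_ret_ketZero, Set.indicator_of_notMem hmem]
    simp
  | cons c cs ih =>
    have h0 : 0 ≤ cs.length * η := by
      refine mul_nonneg (Nat.cast_nonneg _) (le_trans ?_ (hA c))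
      have := prob_le_one x (medianOfRuns (A c) m) (S c)
      rw [prob_compl]
      linarith
    calc (fillEntries A m (c :: cs) g).prob x {g | ∀ c, g c ∈ S c}ᶜ
        = expect x (fun y =>
            (fillEntries A m cs (Function.update g c y)).prob x {g | ∀ c, g c ∈ S c}ᶜ)
            (medianOfRuns (A c) m) (ketZero 0) := by
          simp only [prob, fillEntries, expect_andThen]
      _ ≤ expect x (fun y => (S c)ᶜ.indicator 1 y + cs.length * η)
            (medianOfRuns (A c) m) (ketZero 0) := by
          refine expect_mono x (fun y => ?_) _ _
          -- A good entry preserves the invariant that entries off the remaining list are good; for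
          -- a bad one the indicator already pays for certain failure.
          by_cases hy : y ∈ S c
          · rw [Set.indicator_of_notMem (Set.notMem_compl_iff.2 hy), zero_add]
            refine ih _ fun c' hc' => ?_
            by_cases hcc : c' = c
            · subst hcc
              rwa [Function.update_self]
            · rw [Function.update_of_ne hcc]
              exact hg c' (by simp [hcc, hc'])
          · rw [Set.indicator_of_mem (Set.mem_compl hy), Pi.one_apply]
            exact (prob_le_one x _ _).trans (le_add_of_nonneg_right h0)
      _ = (medianOfRuns (A c) m).prob x (S c)ᶜ + cs.length * η := by
          rw [expect_add, expect_const_ketZero, prob]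
      _ ≤ (c :: cs).length * η := by
          rw [List.length_cons]
          push_cast
          linarith [hA c]

theorem le_prob_componentwise {ι : Type} [Fintype ι] [DecidableEq ι] {p : ℝ} (hp : 1 / 2 < p)
    (A : ι → Procedure nv ℓ ℝ) (S : ι → Set ℝ) (hS : ∀ c, (S c).OrdConnected)
    (hA : ∀ c, p ≤ (A c).prob x (S c)) (m : ℕ) :
    1 - Fintype.card ι * Real.exp (-((2 * p - 1) ^ 2 / 2 * m))
      ≤ (componentwise A m).prob x {g | ∀ c, g c ∈ S c} := by
  have h := prob_fillEntries_compl_le x A m S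
    (fun c => prob_medianOfRuns_compl_le x hp (A c) (hS c) (hA c) m) Finset.univ.toList 0
    -- The initial zero vector is harmless: every component is on the list.
    (fun c hc => absurd (Finset.mem_toList.2 (Finset.mem_univ c)) hc)
  rw [prob_compl, Finset.length_toList, Finset.card_univ] at h
  rw [componentwise]
  linarith

end Procedure

end Quantum

/-- A connected graph with an edge has at most twice as many vertices as edges. -/
theorem Boltzmann.card_param_le {nv nh : ℕ} {G : SimpleGraph (Fin nv ⊕ Fin nh)}
    [DecidableRel G.Adj] (hG : G.Connected) (hE : 0 < G.edgeFinset.card) :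
    Fintype.card (Boltzmann.Param G) ≤ 3 * G.edgeFinset.card := by
  -- Spanning-tree bound: at most `E + 1` units, hence at most `2E + 1 ≤ 3E` parameters.
  have h := hG.card_vert_le_card_edgeSet_add_one
  rw [Nat.card_eq_fintype_card, Nat.card_eq_fintype_card, ← SimpleGraph.edgeFinset_card] at h
  rw [Fintype.card_sum, ← SimpleGraph.edgeFinset_card]
  omega

theorem mainTheorem6 (p : ℝ) (hp : 1 / 2 < p) :
    ∃ C : ℝ, 0 < C ∧
      ∀ (nv nh : ℕ) (G : SimpleGraph (Fin nv ⊕ Fin nh)) [DecidableRel G.Adj],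
        G.Connected → 0 < G.edgeFinset.card →
        Fintype.card (Boltzmann.Param G) ≤ 3 * G.edgeFinset.card ∧
        ∀ ε : ℝ, 0 < ε → ε < 1 → ∃ m : ℕ,
          ∀ (N : ℕ), 0 < N →
          ∀ (A : Boltzmann.Param G → Quantum.Procedure nv (Nat.clog 2 N) ℝ)
            (x : Fin N → Fin nv → Bool),
            (Quantum.Procedure.componentwise A m).expectedOps x
                ≤ C * (G.edgeFinset.card * Quantum.Procedure.opsPerComponent x A) *
                  (1 + Real.log (G.edgeFinset.card / ε)) ∧
            ∀ (lam r : ℝ) (θ : Boltzmann.Param G → ℝ) (δ : ℝ),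
              (∀ c, Quantum.ComputesComponent x lam r θ δ p c (A c)) →
              Quantum.ComputesGradient x lam r θ δ (1 - ε)
                (Quantum.Procedure.componentwise A m) := by
  set d : ℝ := (2 * p - 1) ^ 2 / 2 with hd
  have hd0 : 0 < d := by
    have : 0 < 2 * p - 1 := by linarith
    positivity
  -- The `3` counts components per edge; `2 / d + 1` bounds `m`, using `log 3 ≤ 2` and one unit for
  -- rounding up.
  refine ⟨3 * (2 / d + 1), by positivity, fun nv nh G _ hG hE => ?_⟩
  have hcard := Boltzmann.card_param_le hG hE
  refine ⟨hcard, fun ε hε0 hε1 => ?_⟩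
  have hcard' : (Fintype.card (Boltzmann.Param G) : ℝ) ≤ 3 * (G.edgeFinset.card : ℝ) := by
    exact_mod_cast hcard
  have hE1 : (1 : ℝ) ≤ G.edgeFinset.card := by exact_mod_cast hE
  generalize (G.edgeFinset.card : ℝ) = E at hcard' hE1 ⊢
  have hEε : 1 ≤ E / ε := by
    rw [le_div_iff₀ hε0]
    linarith
  have hlog : 0 ≤ Real.log (E / ε) := Real.log_nonneg hEε
  have hlog3 : Real.log (3 * (E / ε)) = Real.log 3 + Real.log (E / ε) :=
    Real.log_mul (by norm_num) (by positivity)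
  have h3 : Real.log 3 ≤ 2 := by
    linarith [Real.log_le_sub_one_of_pos (show (0 : ℝ) < 3 by norm_num)]
  have h3' : 0 ≤ Real.log 3 := Real.log_nonneg (by norm_num)
  -- Chosen so that `3E · exp (-d m) ≤ ε`.
  set m : ℕ := ⌈Real.log (3 * (E / ε)) / d⌉₊ with hm
  have hm1 : Real.log (3 * (E / ε)) / d ≤ m := Nat.le_ceil _
  have hm2 : (m : ℝ) ≤ (2 / d + 1) * (1 + Real.log (E / ε)) := by
    have h1 : (m : ℝ) ≤ Real.log (3 * (E / ε)) / d + 1 :=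
      (Nat.ceil_lt_add_one (div_nonneg (by linarith) hd0.le)).le
    have h2 : Real.log (3 * (E / ε)) / d ≤ 2 / d * (1 + Real.log (E / ε)) := by
      rw [div_mul_eq_mul_div]
      exact div_le_div_of_nonneg_right (by linarith) hd0.le
    linarith
  refine ⟨m, fun N _ A x => ⟨?_, fun lam r θ δ hA => ?_⟩⟩
  · have hops := Quantum.Procedure.opsPerComponent_nonneg x A
    calc (Quantum.Procedure.componentwise A m).expectedOps x
        ≤ m * (Fintype.card (Boltzmann.Param G) * Quantum.Procedure.opsPerComponent x A) :=
          Quantum.Procedure.expectedOps_componentwise_le x A m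
      _ ≤ (2 / d + 1) * (1 + Real.log (E / ε)) *
            (3 * E * Quantum.Procedure.opsPerComponent x A) := by gcongr
      _ = _ := by ring
  · have hfail : Fintype.card (Boltzmann.Param G) * Real.exp (-(d * m)) ≤ ε := by
      have hdm : Real.log (3 * (E / ε)) ≤ d * m := by
        rwa [div_le_iff₀' hd0] at hm1
      calc Fintype.card (Boltzmann.Param G) * Real.exp (-(d * m))
          ≤ 3 * E * Real.exp (-Real.log (3 * (E / ε))) := by gcongr
        _ = ε := by
          rw [Real.exp_neg, Real.exp_log (by positivity)]
          field_simp
    have h := Quantum.Procedure.le_prob_componentwise x hp A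
      (fun c => {y | |y - r * Boltzmann.gradML x lam θ c| ≤ δ}) (fun c => ?_) hA m
    · exact le_trans (sub_le_sub_left hfail 1) h
    · have hIcc : {y | |y - r * Boltzmann.gradML x lam θ c| ≤ δ}
          = Metric.closedBall (r * Boltzmann.gradML x lam θ c) δ := rfl
      rw [hIcc, Real.closedBall_eq_Icc]
      exact Set.ordConnected_Icc
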